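/- Let $\nu,k\in\mathbb N$ with $k\ge 1$, and give $\mathbb Z^\nu$ the metric $d(x,y)=\max_j|x_j-y_j|$. For finite $\Lambda\subset\mathbb Z^\nu$ let $\mathcal A_\Lambda=\bigotimes_{x\in\Lambda}\mathbb M_k$. For $\Lambda_0\subset\Lambda$ embed $\mathcal A_{\Lambda_0}$ isometrically in $\mathcal A_\Lambda$ by $a\mapsto a\otimes 1_{\Lambda\setminus\Lambda_0}$, let $\mathcal A^{\mathrm{loc}}=\bigcup_\Lambda\mathcal A_\Lambda$, and let $\mathcal A$ be its norm completion (the quasi-local $C^*$-algebra). Let $F:[0,\infty)\to(0,\infty)$ be an $F$-function: $F$ is non-increasing, $\sup_x\sum_y F(d(x,y))<\infty$, and there is $C_F>0$ with $\sum_z F(d(x,z))F(d(z,y))\le C_F F(d(x,y))$ for all $x,y\in\mathbb Z^\nu$. Let $(\Omega,\mathcal F,\mathbb P)$ be a probability space, and let $\mathfrak h$ be a disordered interaction, that is, a map assigning to each $\omega\in\Omega$ and each finite $Z\subset\mathbb Z^\nu$ an element $\mathfrak h(\omega,Z)\in\mathcal A^{\mathrm{loc}}$ such that for each finite $Z$: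 (i) $\mathfrak h(\omega,Z)=\mathfrak h(\omega,Z)^*\in\mathcal A_Z$ for almost every $\omega$; (ii) $\omega\mapsto\varphi(\mathfrak h(\omega,Z))$ is measurable for every $\varphi\in\mathcal A^*$. Put $$\mathcal N(\omega)=\sup_{x,y\in\mathbb Z^\nu}\ \sum_{Z\ni x,y}\|\mathfrak h(\omega,Z)\|\,F(d(x,y))^{-1}\in[0,\infty],$$ where the sum is over finite $Z$, and assume that $\mathcal N<\infty$ almost surely. For finite $\Lambda$ let $$H^\Lambda_\omega=\sum_{Z\subset\Lambda}\mathfrak h(\omega,Z),\qquad U^\Lambda_\omega(t)=e^{-itH^\Lambda_\omega},\qquad \alpha^\Lambda_{t;\omega}(a)=U^\Lambda_\omega(-t)\,a\,U^\Lambda_\omega(t).$$ Let $G$ be the event that $\mathcal N(\omega)<\infty$ and $\mathfrak h(\omega,Z)=\mathfrak h(\omega,Z)^*\in\mathcal A_Z$ for all finite $Z$. Then $G$ is measurable and $\mathbb P(G)=1$. For all $\omega\in G$, $t\in\mathbb R$ and $a\in\mathcal A^{\mathrm{loc}}$, and for every sequence $(\Lambda_n)$ of finite sets with $\Lambda_n\subset\Lambda_{n+1}$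 and $\bigcup_n\Lambda_n=\mathbb Z^\nu$, the norm limit $$\alpha_{t;\omega}(a)=\lim_{n\to\infty}\alpha^{\Lambda_n}_{t;\omega}(a)\in\mathcal A$$ exists, and it does not depend on the sequence $(\Lambda_n)$. Moreover, with $\alpha_{t;\omega}(a):=0$ for $\omega\notin G$, the function $\omega\mapsto\varphi(\alpha_{t;\omega}(a))\in\mathbb C$ is measurable on $\Omega$ for all $t\in\mathbb R$, $a\in\mathcal A^{\mathrm{loc}}$ and $\varphi\in\mathcal A^*$. -/

import Mathlib

open Filter Topology MeasureTheory
open scoped NNReal ENNReal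

noncomputable section

namespace SpinSystem

/-! ### Local matrix algebras over the lattice -/

/-- The lattice `ℤ^ν`. As a function space on `Fin ν` it carries the `ℓ^∞` metric. -/
abbrev Site (ν : ℕ) : Type := Fin ν → ℤ

/-- Finite volumes. -/
abbrev Volume (ν : ℕ) : Type := Finset (Site ν)

/-- Classical configurations on `Λ`; they index the product basis of `⨂_{x ∈ Λ} ℂ^k`. -/
abbrev Config (ν k : ℕ) (Λ : Volume ν) : Type := Λ → Fin k

/-- The algebra `⨂_{x ∈ Λ} M_k` of the finite volume `Λ`, as the matrices over the product basis
of `⨂_{x ∈ Λ} ℂ^k`. Its norm is the operator norm. -/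
abbrev MatrixAlgebra (ν k : ℕ) (Λ : Volume ν) : Type := Matrix (Config ν k Λ) (Config ν k Λ) ℂ

/-- A configuration on `Λ` is a configuration on `Λ₀` together with one on `Λ \ Λ₀`. -/
def splitConfig (ν k : ℕ) {Λ₀ Λ : Volume ν} (h : Λ₀ ≤ Λ) :
    Config ν k Λ ≃ Config ν k Λ₀ × Config ν k (Λ \ Λ₀) where
  toFun σ := (fun x => σ ⟨x.1, h x.2⟩, fun x => σ ⟨x.1, (Finset.mem_sdiff.1 x.2).1⟩)
  invFun p := fun x =>
    if hx : x.1 ∈ Λ₀ then p.1 ⟨x.1, hx⟩ else p.2 ⟨x.1, Finset.mem_sdiff.2 ⟨x.2, hx⟩⟩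
  left_inv σ := by
    funext x
    by_cases hx : x.1 ∈ Λ₀ <;> simp [hx]
  right_inv p := by
    refine Prod.ext ?_ ?_
    · funext x
      simp
    · funext x
      simp [(Finset.mem_sdiff.1 x.2).2]

open scoped Kronecker in
/-- The inclusion `a ↦ a ⊗ 1_{Λ \ Λ₀}`. -/
def embed (ν k : ℕ) {Λ₀ Λ : Volume ν} (h : Λ₀ ≤ Λ) :
    MatrixAlgebra ν k Λ₀ →⋆ₐ[ℂ] MatrixAlgebra ν k Λ where
  toFun a := (a ⊗ₖ (1 : MatrixAlgebra ν k (Λ \ Λ₀))).submatrix (splitConfig ν k h) (splitConfig ν k h)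
  map_one' := by
    rw [Matrix.one_kronecker_one, Matrix.submatrix_one_equiv]
  map_mul' a b := by
    rw [Matrix.submatrix_mul_equiv, ← Matrix.mul_kronecker_mul, one_mul]
  map_zero' := by
    rw [Matrix.zero_kronecker, Matrix.submatrix_zero]; rfl
  map_add' a b := by
    rw [Matrix.add_kronecker, Matrix.submatrix_add]; rfl
  commutes' r := by
    rw [Algebra.algebraMap_eq_smul_one, Algebra.algebraMap_eq_smul_one, Matrix.smul_kronecker,
      Matrix.one_kronecker_one, Matrix.submatrix_smul]
    simp
  map_star' a := by
    simp only [Matrix.star_eq_conjTranspose]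
    rw [Matrix.conjTranspose_submatrix, Matrix.conjTranspose_kronecker, Matrix.conjTranspose_one]

theorem embed_apply (ν k : ℕ) {Λ₀ Λ : Volume ν} (h : Λ₀ ≤ Λ) (a : MatrixAlgebra ν k Λ₀)
    (σ τ : Config ν k Λ) :
    embed ν k h a σ τ = a (fun x => σ ⟨x.1, h x.2⟩) (fun x => τ ⟨x.1, h x.2⟩) *
      if ∀ x : Λ, x.1 ∉ Λ₀ → σ x = τ x then 1 else 0 := by
  have key : ((splitConfig ν k h σ).2 = (splitConfig ν k h τ).2) ↔
      ∀ x : Λ, x.1 ∉ Λ₀ → σ x = τ x := by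
    constructor
    · intro H x hx
      exact congrFun H ⟨x.1, Finset.mem_sdiff.2 ⟨x.2, hx⟩⟩
    · intro H
      funext x
      exact H ⟨x.1, (Finset.mem_sdiff.1 x.2).1⟩ (Finset.mem_sdiff.1 x.2).2
  have : embed ν k h a σ τ = a (splitConfig ν k h σ).1 (splitConfig ν k h τ).1 *
      (1 : MatrixAlgebra ν k (Λ \ Λ₀)) (splitConfig ν k h σ).2 (splitConfig ν k h τ).2 := rfl
  rw [this, Matrix.one_apply]
  simp only [key]
  rfl

theorem embed_injective (ν k : ℕ) [NeZero k] {Λ₀ Λ : Volume ν} (h : Λ₀ ≤ Λ) :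
    Function.Injective (embed ν k h) := by
  intro a b hab
  ext σ τ
  let e := splitConfig ν k h
  have := congrFun (congrFun hab (e.symm (σ, fun _ => 0))) (e.symm (τ, fun _ => 0))
  simpa [embed, e] using this

instance (ν k : ℕ) :
    DirectedSystem (MatrixAlgebra ν k) (fun _ _ h => embed ν k h) where
  map_self Λ a := by
    ext σ τ
    rw [embed_apply]
    simp
  map_map Λ₁ Λ₂ Λ₃ h₁₂ h₂₃ a := by
    ext σ τ
    simp only [embed_apply]
    rw [mul_assoc]
    congr 1
    have key : (∀ x : Λ₁, x.1 ∉ Λ₃ → σ x = τ x) ↔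
        (∀ x : Λ₂, x.1 ∉ Λ₃ → σ ⟨x.1, h₂₃ x.2⟩ = τ ⟨x.1, h₂₃ x.2⟩) ∧
          ∀ x : Λ₁, x.1 ∉ Λ₂ → σ x = τ x := by
      constructor
      · intro H
        exact ⟨fun x hx => H ⟨x.1, h₂₃ x.2⟩ hx, fun x hx => H x fun h => hx (h₁₂ h)⟩
      · rintro ⟨h₁, h₂⟩ x hx
        by_cases hx' : x.1 ∈ Λ₂
        · exact h₁ ⟨x.1, hx'⟩ hx
        · exact h₂ x hx'
    simp only [key]
    split_ifs <;> simp_all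

/-! ### The algebra of local observables as a union (direct limit) of the finite-volume algebras -/

/-- The union of the algebras `⨂_{x ∈ Λ} M_k` along the inclusions `a ↦ a ⊗ 1`. -/
def LocalAlgebra (ν k : ℕ) : Type :=
  DirectLimit (MatrixAlgebra ν k) (fun _ _ h => embed ν k h)

instance (ν k : ℕ) : Ring (LocalAlgebra ν k) :=
  inferInstanceAs (Ring (DirectLimit (MatrixAlgebra ν k) (fun _ _ h => embed ν k h)))

instance (ν k : ℕ) : Algebra ℂ (LocalAlgebra ν k) :=
  inferInstanceAs (Algebra ℂ (DirectLimit (MatrixAlgebra ν k) (fun _ _ h => embed ν k h)))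

instance (ν k : ℕ) : StarRing (LocalAlgebra ν k) :=
  inferInstanceAs (StarRing (DirectLimit (MatrixAlgebra ν k) (fun _ _ h => embed ν k h)))

instance (ν k : ℕ) : StarModule ℂ (LocalAlgebra ν k) :=
  inferInstanceAs (StarModule ℂ (DirectLimit (MatrixAlgebra ν k) (fun _ _ h => embed ν k h)))

/-- The inclusion of the algebra of the volume `Λ` into the local observables. -/
def toLocal (ν k : ℕ) (Λ : Volume ν) : MatrixAlgebra ν k Λ →⋆ₐ[ℂ] LocalAlgebra ν k where
  toFun a := (⟦⟨Λ, a⟩⟧ : DirectLimit (MatrixAlgebra ν k) (fun _ _ h => embed ν k h))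
  map_one' := (DirectLimit.one_def Λ).symm
  map_mul' a b := (DirectLimit.mul_def Λ a b).symm
  map_zero' := (DirectLimit.zero_def Λ).symm
  map_add' a b := (DirectLimit.add_def Λ a b).symm
  commutes' r := (DirectLimit.algebraMap_def Λ r).symm
  map_star' _ := rfl

theorem toLocal_embed (ν k : ℕ) {Λ₀ Λ : Volume ν} (h : Λ₀ ≤ Λ) (a : MatrixAlgebra ν k Λ₀) :
    toLocal ν k Λ (embed ν k h a) = toLocal ν k Λ₀ a :=
  DirectLimit.mk_apply Λ₀ Λ a h

theorem exists_toLocal (ν k : ℕ) (a : LocalAlgebra ν k) : ∃ Λ a', a = toLocal ν k Λ a' :=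
  DirectLimit.exists_eq_mk _ a

theorem exists_toLocal₂ (ν k : ℕ) (a b : LocalAlgebra ν k) :
    ∃ Λ a' b', a = toLocal ν k Λ a' ∧ b = toLocal ν k Λ b' :=
  DirectLimit.exists_eq_mk₂ _ a b

section Norm

open scoped Matrix.Norms.L2Operator

variable (ν k : ℕ) [NeZero k]

theorem norm_embed {Λ₀ Λ : Volume ν} (h : Λ₀ ≤ Λ) (a : MatrixAlgebra ν k Λ₀) :
    ‖embed ν k h a‖ = ‖a‖ :=
  NonUnitalStarAlgHom.norm_map (embed ν k h) (embed_injective ν k h) a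

/-- The common value of the operator norms of the finite-volume representatives. -/
def localNorm (a : LocalAlgebra ν k) : ℝ :=
  DirectLimit.lift (fun _ _ h => embed ν k h) (fun _ a => ‖a‖)
    (fun _ _ h a => (norm_embed ν k h a).symm) a

theorem localNorm_toLocal (Λ : Volume ν) (a : MatrixAlgebra ν k Λ) :
    localNorm ν k (toLocal ν k Λ a) = ‖a‖ := rfl

instance : NormedAddCommGroup (LocalAlgebra ν k) :=
  AddGroupNorm.toNormedAddCommGroup
    { toFun := localNorm ν k
      map_zero' := by
        rw [← map_zero (toLocal ν k ∅), localNorm_toLocal, norm_zero]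
      add_le' := by
        intro a b
        obtain ⟨Λ, a, b, rfl, rfl⟩ := exists_toLocal₂ ν k a b
        rw [← map_add]
        exact norm_add_le a b
      neg' := by
        intro a
        obtain ⟨Λ, a, rfl⟩ := exists_toLocal ν k a
        rw [← map_neg]
        exact norm_neg a
      eq_zero_of_map_eq_zero' := by
        intro a ha
        obtain ⟨Λ, a, rfl⟩ := exists_toLocal ν k a
        rw [localNorm_toLocal, norm_eq_zero] at ha
        rw [ha, map_zero] }

theorem norm_toLocal (Λ : Volume ν) (a : MatrixAlgebra ν k Λ) : ‖toLocal ν k Λ a‖ = ‖a‖ := rfl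

instance : NormedRing (LocalAlgebra ν k) where
  __ := (inferInstance : NormedAddCommGroup (LocalAlgebra ν k))
  __ := (inferInstance : Ring (LocalAlgebra ν k))
  norm_mul_le a b := by
    obtain ⟨Λ, a, b, rfl, rfl⟩ := exists_toLocal₂ ν k a b
    rw [← map_mul]
    exact norm_mul_le a b

instance : NormedAlgebra ℂ (LocalAlgebra ν k) where
  norm_smul_le c a := by
    obtain ⟨Λ, a, rfl⟩ := exists_toLocal ν k a
    rw [← map_smul]
    exact norm_smul_le c a

instance : CStarRing (LocalAlgebra ν k) where
  norm_mul_self_le a := by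
    obtain ⟨Λ, a, rfl⟩ := exists_toLocal ν k a
    rw [← map_star, ← map_mul]
    exact CStarRing.norm_mul_self_le a

end Norm

/-! ### The quasi-local algebra -/

section Quasilocal

open UniformSpace

variable (ν k : ℕ) [NeZero k]

/-- The norm completion of the algebra of local observables. -/
def QuasilocalAlgebra : Type := Completion (LocalAlgebra ν k)

instance : NormedRing (QuasilocalAlgebra ν k) :=
  inferInstanceAs (NormedRing (Completion (LocalAlgebra ν k)))

instance : CompleteSpace (QuasilocalAlgebra ν k) :=
  inferInstanceAs (CompleteSpace (Completion (LocalAlgebra ν k)))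

instance : NormedAlgebra ℂ (QuasilocalAlgebra ν k) where
  __ := (inferInstance : Algebra ℂ (Completion (LocalAlgebra ν k)))
  norm_smul_le c a := norm_smul_le (β := Completion (LocalAlgebra ν k)) c a

theorem uniformContinuous_star_local :
    UniformContinuous (star : LocalAlgebra ν k → LocalAlgebra ν k) :=
  (starₗᵢ ℂ : LocalAlgebra ν k ≃ₗᵢ⋆[ℂ] LocalAlgebra ν k).isometry.uniformContinuous

/-- The adjoint is extended from the local observables by continuity. -/
instance : Star (QuasilocalAlgebra ν k) where
  star := Completion.map (star : LocalAlgebra ν k → LocalAlgebra ν k)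

theorem continuous_star_quasilocal :
    Continuous (star : QuasilocalAlgebra ν k → QuasilocalAlgebra ν k) :=
  Completion.continuous_map

/-- The inclusion of the local observables into the quasi-local algebra. -/
def ofLocal : LocalAlgebra ν k →⋆ₐ[ℂ] QuasilocalAlgebra ν k where
  toFun a := (a : Completion (LocalAlgebra ν k))
  map_one' := Completion.coe_one _
  map_mul' a b := Completion.coe_mul a b
  map_zero' := Completion.coe_zero
  map_add' a b := Completion.coe_add a b
  commutes' _ := rfl
  map_star' a := (Completion.map_coe (uniformContinuous_star_local ν k) a).symm

theorem norm_ofLocal (a : LocalAlgebra ν k) : ‖ofLocal ν k a‖ = ‖a‖ :=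
  Completion.norm_coe a

theorem denseRange_ofLocal : DenseRange (ofLocal ν k) :=
  Completion.denseRange_coe

instance : StarRing (QuasilocalAlgebra ν k) where
  star_involutive a := by
    have hs := continuous_star_quasilocal ν k
    refine (denseRange_ofLocal ν k).induction_on a
      (isClosed_eq (hs.comp hs) continuous_id) fun a => ?_
    rw [← map_star, ← map_star, star_star]
  star_mul a b := by
    have hs := continuous_star_quasilocal ν k
    refine (denseRange_ofLocal ν k).induction_on₂ (isClosed_eq (by fun_prop) (by fun_prop))
      (fun a b => ?_) a b
    rw [← map_mul, ← map_star, ← map_star, ← map_star, ← map_mul, star_mul]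
  star_add a b := by
    have hs := continuous_star_quasilocal ν k
    refine (denseRange_ofLocal ν k).induction_on₂ (isClosed_eq (by fun_prop) (by fun_prop))
      (fun a b => ?_) a b
    rw [← map_add, ← map_star, ← map_star, ← map_star, ← map_add, star_add]

instance : CStarRing (QuasilocalAlgebra ν k) where
  norm_mul_self_le a := by
    have hs := continuous_star_quasilocal ν k
    refine (denseRange_ofLocal ν k).induction_on a
      (isClosed_le (by fun_prop) (by fun_prop)) fun a => ?_
    rw [← map_star, ← map_mul, norm_ofLocal, norm_ofLocal]
    exact CStarRing.norm_mul_self_le a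

instance : StarModule ℂ (QuasilocalAlgebra ν k) where
  star_smul c a := by
    have hs := continuous_star_quasilocal ν k
    refine (denseRange_ofLocal ν k).induction_on a
      (isClosed_eq (hs.comp (continuous_const_smul c)) ((continuous_const_smul (star c)).comp hs))
      fun a => ?_
    rw [← map_star, ← map_smul, ← map_smul, ← map_star, star_smul]

instance : CStarAlgebra (QuasilocalAlgebra ν k) where

/-- The local observables, as a subalgebra of the quasi-local algebra. -/
def localObservables : StarSubalgebra ℂ (QuasilocalAlgebra ν k) := (ofLocal ν k).range

/-- The observables of the finite volume `Λ`, as a subalgebra of the quasi-local algebra. -/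
def volumeAlgebra (Λ : Volume ν) : StarSubalgebra ℂ (QuasilocalAlgebra ν k) :=
  ((ofLocal ν k).comp (toLocal ν k Λ)).range

theorem mem_localObservables (a : QuasilocalAlgebra ν k) :
    a ∈ localObservables ν k ↔ ∃ Λ, a ∈ volumeAlgebra ν k Λ := by
  constructor
  · rintro ⟨a, rfl⟩
    obtain ⟨Λ, a, rfl⟩ := exists_toLocal ν k a
    exact ⟨Λ, a, rfl⟩
  · rintro ⟨Λ, a, rfl⟩
    exact ⟨toLocal ν k Λ a, rfl⟩

end Quasilocal

/-! ### Disordered interactions, Hamiltonians and dynamics -/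

/-- `Λ` is an increasing and absorbing sequence of finite volumes. -/
structure IsIAS {ν : ℕ} (Λ : ℕ → Volume ν) : Prop where
  subset_succ : ∀ n, Λ n ⊆ Λ (n + 1)
  absorbing : ∀ x, ∃ n, x ∈ Λ n

/-- `F : [0, ∞) → (0, ∞)` is an `F`-function on `ℤ^ν`. -/
structure IsFFunction (ν : ℕ) (F : ℝ≥0 → ℝ≥0) : Prop where
  pos : ∀ r, 0 < F r
  antitone : Antitone F
  summable : ⨆ x : Site ν, ∑' y : Site ν, (F (nndist x y) : ℝ≥0∞) < ∞
  convolution : ∃ C : ℝ≥0, 0 < C ∧ ∀ x y : Site ν,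
    ∑' z : Site ν, (F (nndist x z) : ℝ≥0∞) * (F (nndist z y) : ℝ≥0∞) ≤ C * F (nndist x y)

section Interaction

variable {ν k : ℕ} [NeZero k] {Ω : Type*}

/-- `h` is a disordered interaction over the probability space `(Ω, P)`. -/
structure IsDisorderedInteraction [MeasurableSpace Ω] (P : Measure Ω)
    (h : Ω → Volume ν → QuasilocalAlgebra ν k) : Prop where
  mem_local : ∀ ω Z, h ω Z ∈ localObservables ν k
  selfAdjoint : ∀ Z, ∀ᵐ ω ∂P, IsSelfAdjoint (h ω Z) ∧ h ω Z ∈ volumeAlgebra ν k Z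
  measurable : ∀ Z, ∀ φ : StrongDual ℂ (QuasilocalAlgebra ν k), Measurable fun ω => φ (h ω Z)

/-- The `F`-norm of the interaction at the realization `ω` of the disorder. -/
def fNorm (F : ℝ≥0 → ℝ≥0) (h : Ω → Volume ν → QuasilocalAlgebra ν k) (ω : Ω) : ℝ≥0∞ :=
  ⨆ (x : Site ν) (y : Site ν),
    ∑' Z : {Z : Volume ν // x ∈ Z ∧ y ∈ Z}, ‖h ω Z‖ₑ * (F (nndist x y) : ℝ≥0∞)⁻¹

/-- The Hamiltonian `H^Λ_ω = ∑_{Z ⊆ Λ} h(ω, Z)`. -/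
def hamiltonian (h : Ω → Volume ν → QuasilocalAlgebra ν k) (Λ : Volume ν) (ω : Ω) :
    QuasilocalAlgebra ν k :=
  ∑ Z ∈ Λ.powerset, h ω Z

/-- `U^Λ_ω(t) = exp(-i t H^Λ_ω)`. -/
def propagator (h : Ω → Volume ν → QuasilocalAlgebra ν k) (Λ : Volume ν) (ω : Ω) (t : ℝ) :
    QuasilocalAlgebra ν k :=
  NormedSpace.exp ((-(Complex.I * t)) • hamiltonian h Λ ω)

/-- The Heisenberg dynamics `α^Λ_{t;ω}(a) = U^Λ_ω(-t) a U^Λ_ω(t)`. -/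
def localDynamics (h : Ω → Volume ν → QuasilocalAlgebra ν k) (Λ : Volume ν) (t : ℝ) (ω : Ω)
    (a : QuasilocalAlgebra ν k) : QuasilocalAlgebra ν k :=
  propagator h Λ ω (-t) * a * propagator h Λ ω t

/-- The event that the `F`-norm is finite and that `h(ω, ·)` is an interaction, that is,
`h(ω, Z) = h(ω, Z)^* ∈ A_Z` for every finite volume `Z`. -/
def regularEvent (F : ℝ≥0 → ℝ≥0) (h : Ω → Volume ν → QuasilocalAlgebra ν k) : Set Ω :=
  {ω | fNorm F h ω < ∞ ∧ ∀ Z, IsSelfAdjoint (h ω Z) ∧ h ω Z ∈ volumeAlgebra ν k Z}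

end Interaction

end SpinSystem

end

namespace SpinSystem

/-! ### Heisenberg evolutions in a `C⋆`-algebra -/

section Evolution

variable {A : Type*} [CStarAlgebra A]

/-! Fix `ω` in the regular event. The interaction then decays like `F`, and its dynamics has finite
speed up to `F`-tails: `lieb_robinson` bounds the commutator of an evolved `a ∈ A_X` with `b ∈ A_Y`
by a multiple of `∑ x ∈ X, ∑ y ∈ Y, F(d(x,y))`, with constants independent of the volume. For `Λ ⊆
Λ'`, Duhamel's formula bounds the difference of the two evolutions of `a` by commutators of the
evolved `a` with the terms `Z` that meet `Λ' \ Λ`. The convolution property of `F` bounds their sum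
by a multiple of `∑ z ∈ Λ' \ Λ, ∑ x ∈ X, F(d(x,z))`, the tail of a convergent series
(`norm_evolve_sub_le`). The dynamics is thus a Cauchy net over all finite volumes, and its limit
serves every exhausting sequence.

For measurability, the quasi-local algebra is separable, so weak measurability gives Borel
measurability (`measurable_of_forall_dual`). Each finite-volume dynamics is a continuous function of
finitely many `h(ω, Z)`, and the limit runs along a countable directed set. -/

theorem neg_commutator (a b : A) : ⁅-a, b⁆ = -⁅a, b⁆ := by
  simp only [Ring.lie_def]; noncomm_ring

/-- The Heisenberg evolution `a ↦ exp(itH) a exp(-itH)`. -/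
noncomputable def evolve (H : A) (t : ℝ) (a : A) : A :=
  NormedSpace.exp (t • (Complex.I • H)) * a * NormedSpace.exp ((-t) • (Complex.I • H))

theorem exp_smul_mul_exp_neg_smul (x : A) (t : ℝ) :
    NormedSpace.exp (t • x) * NormedSpace.exp ((-t) • x) = 1 := by
  let +nondep : NormedAlgebra ℚ A := .restrictScalars ℚ ℂ A
  have hc : Commute (t • x) ((-t) • x) := ((Commute.refl x).smul_left t).smul_right (-t)
  have := NormedSpace.exp_add_of_commute hc
  rw [← this, ← add_smul, add_neg_cancel, zero_smul, NormedSpace.exp_zero]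

theorem exp_neg_smul_mul_exp_smul (x : A) (t : ℝ) :
    NormedSpace.exp ((-t) • x) * NormedSpace.exp (t • x) = 1 := by
  simpa using exp_smul_mul_exp_neg_smul x (-t)

theorem evolve_zero (H a : A) : evolve H 0 a = a := by simp [evolve]

theorem evolve_neg_evolve (H : A) (t : ℝ) (a : A) : evolve H (-t) (evolve H t a) = a := by
  simp only [evolve, neg_neg]
  set u := NormedSpace.exp (t • (Complex.I • H))
  set v := NormedSpace.exp ((-t) • (Complex.I • H))
  have hvu : v * u = 1 := exp_neg_smul_mul_exp_smul _ t
  calc v * (u * a * v) * u = (v * u) * a * (v * u) := by noncomm_ring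
    _ = a := by rw [hvu]; simp

theorem evolve_evolve_neg (H : A) (t : ℝ) (a : A) : evolve H t (evolve H (-t) a) = a := by
  simpa using evolve_neg_evolve H (-t) a

theorem evolve_mul (H : A) (t : ℝ) (a b : A) :
    evolve H t (a * b) = evolve H t a * evolve H t b := by
  simp only [evolve]
  set u := NormedSpace.exp (t • (Complex.I • H))
  set v := NormedSpace.exp ((-t) • (Complex.I • H))
  have hvu : v * u = 1 := exp_neg_smul_mul_exp_smul _ t
  calc u * (a * b) * v = u * a * 1 * b * v := by noncomm_ring
    _ = u * a * v * (u * b * v) := by rw [← hvu]; noncomm_ring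

theorem evolve_sub (H : A) (t : ℝ) (a b : A) :
    evolve H t (a - b) = evolve H t a - evolve H t b := by
  simp only [evolve]; noncomm_ring

theorem evolve_sum {ι : Type*} (H : A) (t : ℝ) (s : Finset ι) (f : ι → A) :
    evolve H t (∑ i ∈ s, f i) = ∑ i ∈ s, evolve H t (f i) := by
  simp only [evolve, Finset.mul_sum, Finset.sum_mul]

theorem evolve_lie (H : A) (t : ℝ) (a b : A) : evolve H t ⁅a, b⁆ = ⁅evolve H t a, evolve H t b⁆ := by
  simp only [Ring.lie_def, evolve_sub, evolve_mul]

theorem evolve_neg_left (H : A) (t : ℝ) (a : A) : evolve (-H) t a = evolve H (-t) a := by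
  simp [evolve]

theorem evolve_eq_self_of_commute {H a : A} (h : Commute H a) (t : ℝ) : evolve H t a = a := by
  have hc : Commute (t • (Complex.I • H)) a := (h.smul_left _).smul_left _
  have he : Commute (NormedSpace.exp (t • (Complex.I • H))) a := hc.exp_left
  rw [evolve, he.eq, mul_assoc, exp_smul_mul_exp_neg_smul, mul_one]

theorem norm_evolve {H : A} (hH : IsSelfAdjoint H) (t : ℝ) (a : A) : ‖evolve H t a‖ = ‖a‖ := by
  have hu : ∀ s : ℝ, NormedSpace.exp (s • (Complex.I • H)) ∈ unitary A := by
    intro s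
    let +nondep : NormedAlgebra ℚ A := .restrictScalars ℚ ℂ A
    refine NormedSpace.exp_mem_unitary_of_mem_skewAdjoint ?_
    rw [skewAdjoint.mem_iff]
    simp [hH.star_eq]
  rw [evolve, CStarRing.norm_mul_mem_unitary _ (hu _), CStarRing.norm_mem_unitary_mul _ (hu _)]

theorem hasDerivAt_evolve {b : ℝ → A} {b' : A} (H : A) {t : ℝ} (hb : HasDerivAt b b' t) :
    HasDerivAt (fun s => evolve H s (b s)) (evolve H t (⁅Complex.I • H, b t⁆ + b')) t := by
  have h1 := hasDerivAt_exp_smul_const (𝕂 := ℝ) (Complex.I • H) t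
  have h2 := (hasDerivAt_exp_smul_const' (𝕂 := ℝ) (Complex.I • H) (-t)).scomp t (hasDerivAt_neg t)
  refine ((h1.mul hb).mul h2).congr_deriv ?_
  simp only [evolve, Function.comp, Ring.lie_def, neg_one_smul, Pi.mul_apply]
  noncomm_ring

/-- Duhamel's formula in differential form: since `K` is fixed by its own evolution, only the
difference of the generators survives. -/
theorem hasDerivAt_evolve_evolve_neg (H K b : A) (t : ℝ) :
    HasDerivAt (fun s => evolve H s (evolve K (-s) b))
      (evolve H t (Complex.I • ⁅H - K, evolve K (-t) b⁆)) t := by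
  have h1 : HasDerivAt (fun s => evolve K (-s) b) (-⁅Complex.I • K, evolve K (-t) b⁆) t := by
    have := hasDerivAt_evolve (-K) (hasDerivAt_const t b)
    simp only [evolve_neg_left, add_zero, smul_neg] at this
    convert this using 1
    rw [evolve_lie, evolve_eq_self_of_commute (H := K) (a := -(Complex.I • K)), neg_commutator]
    exact ((Commute.refl K).smul_right _).neg_right
  convert hasDerivAt_evolve H h1 using 2
  simp only [Ring.lie_def, sub_mul, mul_sub, smul_sub, smul_mul_assoc, mul_smul_comm]
  abel

theorem norm_lie_le (a b : A) : ‖⁅a, b⁆‖ ≤ 2 * ‖a‖ * ‖b‖ := by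
  rw [Ring.lie_def]
  calc ‖a * b - b * a‖ ≤ ‖a * b‖ + ‖b * a‖ := norm_sub_le _ _
    _ ≤ ‖a‖ * ‖b‖ + ‖b‖ * ‖a‖ := add_le_add (norm_mul_le _ _) (norm_mul_le _ _)
    _ = 2 * ‖a‖ * ‖b‖ := by ring

/-- Two evolutions differ by at most the integral of the commutator with the difference of the
generators, formulated with an upper bound `β` for that integral. -/
theorem norm_evolve_sub_evolve_le {H K : A} (hH : IsSelfAdjoint H)
    (b : A) {β β' : ℝ → ℝ} (h0 : 0 ≤ β 0) (hβ : ∀ s, HasDerivAt β (β' s) s) {t : ℝ} (ht : 0 ≤ t)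
    (bound : ∀ s, 0 ≤ s → ‖⁅H - K, evolve K s b⁆‖ ≤ β' s) :
    ‖evolve H t b - evolve K t b‖ ≤ β t := by
  -- The signs are flipped so that the derivative contains `evolve K s b` at the forward time `s`.
  have key : ‖evolve (-H) t (evolve (-K) (-t) b) - b‖ ≤ β t := by
    have hd : ∀ s, HasDerivAt (fun s => evolve (-H) s (evolve (-K) (-s) b) - b)
        (evolve (-H) s (Complex.I • ⁅(-H) - (-K), evolve (-K) (-s) b⁆)) s := fun s =>
      (hasDerivAt_evolve_evolve_neg (-H) (-K) b s).sub_const b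
    refine image_norm_le_of_norm_deriv_right_le_deriv_boundary (a := 0) (b := t)
      (fun s _ => (hd s).continuousAt.continuousWithinAt) (fun s _ => (hd s).hasDerivWithinAt)
      ?_ hβ ?_ ⟨ht, le_rfl⟩
    · simpa [evolve_zero] using h0
    · intro s hs
      rw [norm_evolve hH.neg, norm_smul, Complex.norm_I, one_mul, evolve_neg_left, neg_neg,
        neg_sub_neg, ← neg_sub, neg_commutator, norm_neg]
      exact bound s hs.1
  have : evolve H t b - evolve K t b = -evolve H t (evolve (-H) t (evolve (-K) (-t) b) - b) := by
    rw [evolve_sub, evolve_neg_left, evolve_neg_left, neg_neg, evolve_evolve_neg, neg_sub]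
  rw [this, norm_neg, norm_evolve hH]
  exact key

/-- The commutator of an evolved observable `a` grows at most as fast as the commutator of the
evolution of the part of the generator that does not commute with `a`. -/
theorem norm_lie_evolve_le {H H' : A} (hH' : IsSelfAdjoint H') {a : A}
    (ha : Commute H' a) (b : A) {β β' : ℝ → ℝ} (h0 : ‖⁅a, b⁆‖ ≤ β 0)
    (hH : IsSelfAdjoint H)
    (hβ : ∀ s, HasDerivAt β (β' s) s) {t : ℝ} (ht : 0 ≤ t)
    (bound : ∀ s, 0 ≤ s → 2 * ‖a‖ * ‖⁅evolve H s (H - H'), b⁆‖ ≤ β' s) :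
    ‖⁅evolve H t a, b⁆‖ ≤ β t := by
  -- Moving the evolution onto `b` and then applying that of `H'`, which fixes `a`, preserves the
  -- norm of the commutator and leaves only `H' - H` in the derivative.
  have key : ‖⁅a, evolve H' t (evolve H (-t) b)⁆‖ ≤ β t := by
    have hd : ∀ s, HasDerivAt (fun s => ⁅a, evolve H' s (evolve H (-s) b)⁆)
        ⁅a, evolve H' s (Complex.I • ⁅H' - H, evolve H (-s) b⁆)⁆ s := by
      intro s
      simp only [Ring.lie_def]
      exact ((hasDerivAt_evolve_evolve_neg H' H b s).const_mul a).sub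
        ((hasDerivAt_evolve_evolve_neg H' H b s).mul_const a)
    refine image_norm_le_of_norm_deriv_right_le_deriv_boundary (a := 0) (b := t)
      (fun s _ => (hd s).continuousAt.continuousWithinAt) (fun s _ => (hd s).hasDerivWithinAt)
      ?_ hβ ?_ ⟨ht, le_rfl⟩
    · simpa [evolve_zero] using h0
    · intro s hs
      refine (norm_lie_le _ _).trans ((le_of_eq ?_).trans (bound s hs.1))
      congr 1
      rw [norm_evolve hH', norm_smul, Complex.norm_I, one_mul, ← norm_evolve hH s, evolve_lie,
        evolve_evolve_neg, ← neg_sub H H', evolve, evolve, mul_neg, neg_mul, neg_commutator, norm_neg]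
  rw [← norm_evolve hH (-t), evolve_lie, evolve_neg_evolve, ← norm_evolve hH' t, evolve_lie,
    evolve_eq_self_of_commute ha]
  exact key

end Evolution

/-! ### Lieb–Robinson bounds and the thermodynamic limit -/

section LiebRobinson

variable {A : Type*} [CStarAlgebra A] {V : Type*} [DecidableEq V]

/-- A self-adjoint interaction `Φ` on the sites `V`, with respect to a net `S` of local observables
commuting at disjoint supports, whose strength decays like the kernel `F`. -/
structure IsDecayingInteraction (S : Finset V → Set A) (F : V → V → ℝ) (K C N : ℝ)
    (Φ : Finset V → A) : Prop where
  commute : ∀ {X Y}, Disjoint X Y → ∀ {a b}, a ∈ S X → b ∈ S Y → Commute a b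
  selfAdjoint : ∀ Z, IsSelfAdjoint (Φ Z)
  mem : ∀ Z, Φ Z ∈ S Z
  kernel_nonneg : ∀ x y, 0 ≤ F x y
  kernel_symm : ∀ x y, F x y = F y x
  K_nonneg : 0 ≤ K
  C_nonneg : 0 ≤ C
  N_nonneg : 0 ≤ N
  diagonal : ∀ x, 1 ≤ K * F x x
  convolution : ∀ (x y) (Λ : Finset V), ∑ z ∈ Λ, F x z * F z y ≤ C * F x y
  decay : ∀ (x y) (Λ : Finset V), ∑ Z ∈ Λ.powerset with x ∈ Z ∧ y ∈ Z, ‖Φ Z‖ ≤ N * F x y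

namespace IsDecayingInteraction

variable {S : Finset V → Set A} {F : V → V → ℝ} {K C N : ℝ} {Φ : Finset V → A}

theorem isSelfAdjoint_sum (hΦ : IsDecayingInteraction S F K C N Φ) (s : Finset (Finset V)) :
    IsSelfAdjoint (∑ Z ∈ s, Φ Z) :=
  _root_.isSelfAdjoint_sum s fun Z _ => hΦ.selfAdjoint Z

/-- A set `Z` meeting `X` contains some `x ∈ X`; summing over all such `x` and exchanging the sums
over `z` and `Z` leaves the sums over `Z ∋ x, z` that `decay` controls. -/
theorem sum_norm_mul_le (hΦ : IsDecayingInteraction S F K C N Φ) (Λ X : Finset V)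
    {g : V → ℝ} (hg : ∀ z, 0 ≤ g z) :
    ∑ Z ∈ Λ.powerset with ¬Disjoint Z X, ‖Φ Z‖ * ∑ z ∈ Z, g z ≤
      N * ∑ x ∈ X, ∑ z ∈ Λ, F x z * g z := by
  have h1 : ∑ Z ∈ Λ.powerset with ¬Disjoint Z X, ‖Φ Z‖ * ∑ z ∈ Z, g z ≤
      ∑ Z ∈ Λ.powerset, ∑ x ∈ X, if x ∈ Z then ‖Φ Z‖ * ∑ z ∈ Z, g z else 0 := by
    rw [Finset.sum_filter]
    refine Finset.sum_le_sum fun Z _ => ?_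
    have h0 : 0 ≤ ‖Φ Z‖ * ∑ z ∈ Z, g z :=
      mul_nonneg (norm_nonneg _) (Finset.sum_nonneg fun z _ => hg z)
    have h0' : ∀ x ∈ X, 0 ≤ if x ∈ Z then ‖Φ Z‖ * ∑ z ∈ Z, g z else 0 := fun x _ => by
      split_ifs
      exacts [h0, le_rfl]
    by_cases hd : Disjoint Z X
    · rw [if_neg (not_not.2 hd)]
      exact Finset.sum_nonneg h0'
    · obtain ⟨x, hxZ, hxX⟩ := Finset.not_disjoint_iff.1 hd
      rw [if_pos hd]
      refine le_trans ?_ (Finset.single_le_sum h0' hxX)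
      rw [if_pos hxZ]
  refine h1.trans ?_
  rw [Finset.sum_comm, Finset.mul_sum]
  refine Finset.sum_le_sum fun x _ => ?_
  have h2 : ∑ Z ∈ Λ.powerset, (if x ∈ Z then ‖Φ Z‖ * ∑ z ∈ Z, g z else 0) =
      ∑ z ∈ Λ, (∑ Z ∈ Λ.powerset with x ∈ Z ∧ z ∈ Z, ‖Φ Z‖) * g z := by
    simp only [Finset.sum_filter, Finset.sum_mul]
    rw [Finset.sum_comm]
    refine Finset.sum_congr rfl fun Z hZ => ?_
    have hsub : Λ.filter (· ∈ Z) = Z := by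
      ext z
      simpa using fun hz => Finset.mem_powerset.1 hZ hz
    by_cases hx : x ∈ Z
    · simp only [hx, true_and, if_true, Finset.mul_sum, ite_mul, zero_mul]
      rw [← Finset.sum_filter, hsub]
    · simp [hx]
  rw [h2, Finset.mul_sum]
  refine Finset.sum_le_sum fun z _ => ?_
  rw [← mul_assoc]
  exact mul_le_mul_of_nonneg_right (hΦ.decay x z Λ) (hg z)

/-- The exponential term is a supersolution of the iteration: by convolution, one step returns at
most its own time derivative. The second term is what remains of the trivial bound after `n` steps.
It depends on `Λ`, but vanishes as `n → ∞`. -/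
theorem lieb_robinson_iterate (hΦ : IsDecayingInteraction S F K C N Φ) (Λ : Finset V)
    {Y : Finset V} {b : A} (hb : b ∈ S Y) (n : ℕ) {X : Finset V} {a : A} (ha : a ∈ S X)
    {t : ℝ} (ht : 0 ≤ t) :
    ‖⁅evolve (∑ Z ∈ Λ.powerset, Φ Z) t a, b⁆‖ ≤
      2 * ‖a‖ * ‖b‖ * (K * Real.exp (2 * N * C * t) * ∑ x ∈ X, ∑ y ∈ Y, F x y +
        (2 * ∑ Z ∈ Λ.powerset, ‖Φ Z‖) ^ n * (t ^ n / n.factorial)) := by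
  set H := ∑ Z ∈ Λ.powerset, Φ Z with hH
  set M := 2 * ∑ Z ∈ Λ.powerset, ‖Φ Z‖ with hM
  have hHs : IsSelfAdjoint H := hΦ.isSelfAdjoint_sum _
  have hM0 : 0 ≤ M := mul_nonneg zero_le_two (Finset.sum_nonneg fun _ _ => norm_nonneg _)
  have hD0 : ∀ X : Finset V, 0 ≤ ∑ x ∈ X, ∑ y ∈ Y, F x y := fun X =>
    Finset.sum_nonneg fun x _ => Finset.sum_nonneg fun y _ => hΦ.kernel_nonneg x y
  have hK := hΦ.K_nonneg
  induction n generalizing X a t with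
  | zero =>
    refine (norm_lie_le _ _).trans ?_
    rw [norm_evolve hHs]
    refine le_mul_of_one_le_right (by positivity) ?_
    have := mul_nonneg (mul_nonneg hK (Real.exp_pos (2 * N * C * t)).le) (hD0 X)
    simpa using this
  | succ n ih =>
    -- These terms commute with `a`; the induction hypothesis is applied to each remaining `Φ Z`,
    -- with `Z` in the role of `X`.
    set H' := ∑ Z ∈ Λ.powerset with Disjoint Z X, Φ Z with hH'
    have hsub : H - H' = ∑ Z ∈ Λ.powerset with ¬Disjoint Z X, Φ Z := by
      rw [hH, hH', ← Finset.sum_filter_add_sum_filter_not Λ.powerset (fun Z => Disjoint Z X),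
        add_sub_cancel_left]
    have hcomm : Commute H' a := by
      refine Finset.sum_induction _ (fun u => Commute u a) (fun _ _ => Commute.add_left)
        (Commute.zero_left a) fun Z hZ => ?_
      exact hΦ.commute (Finset.mem_filter.1 hZ).2 (hΦ.mem Z) ha
    refine norm_lie_evolve_le (H := H) (H' := H') (hΦ.isSelfAdjoint_sum _) hcomm b
      (β := fun s => 2 * ‖a‖ * ‖b‖ * (K * Real.exp (2 * N * C * s) * ∑ x ∈ X, ∑ y ∈ Y, F x y +
        M ^ (n + 1) * (s ^ (n + 1) / (n + 1).factorial)))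
      (β' := fun s => 2 * ‖a‖ * ‖b‖ * (K * (Real.exp (2 * N * C * s) * (2 * N * C)) *
        ∑ x ∈ X, ∑ y ∈ Y, F x y + M ^ (n + 1) * (s ^ n / n.factorial)))
      ?_ hHs ?_ ht ?_
    -- At time zero the commutator vanishes for disjoint supports; otherwise a common site `x` gives
    -- `1 ≤ K * F x x`, and the trivial bound suffices.
    · by_cases hXY : Disjoint X Y
      · have : ⁅a, b⁆ = 0 := by
          rw [Ring.lie_def, (hΦ.commute hXY ha hb).eq, sub_self]
        rw [this, norm_zero]
        have := mul_nonneg hK (hD0 X)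
        simp only [mul_zero, Real.exp_zero, mul_one]
        positivity
      · obtain ⟨x, hxX, hxY⟩ := Finset.not_disjoint_iff.1 hXY
        refine (norm_lie_le a b).trans (le_mul_of_one_le_right (by positivity) ?_)
        have h1 : F x x ≤ ∑ x ∈ X, ∑ y ∈ Y, F x y :=
          (Finset.single_le_sum (f := fun y => F x y) (fun y _ => hΦ.kernel_nonneg x y) hxY).trans
            (Finset.single_le_sum (f := fun x => ∑ y ∈ Y, F x y)
              (fun x _ => Finset.sum_nonneg fun y _ => hΦ.kernel_nonneg x y) hxX)
        have h2 := (hΦ.diagonal x).trans (mul_le_mul_of_nonneg_left h1 hK)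
        simpa using h2
    · intro s
      have h1 : HasDerivAt (fun s => Real.exp (2 * N * C * s))
          (Real.exp (2 * N * C * s) * (2 * N * C)) s := by
        simpa using ((hasDerivAt_id s).const_mul (2 * N * C)).exp
      have h2 : HasDerivAt (fun s : ℝ => s ^ (n + 1) / ((n + 1).factorial : ℝ))
          (s ^ n / n.factorial) s := by
        refine ((hasDerivAt_pow (n + 1) s).div_const _).congr_deriv ?_
        rw [Nat.factorial_succ]
        push_cast
        have : (n.factorial : ℝ) ≠ 0 := by positivity
        have : (n : ℝ) + 1 ≠ 0 := by positivity
        field_simp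
      exact (((h1.const_mul K).mul_const _).add (h2.const_mul _)).const_mul _
    · intro s hs
      set r := s ^ n / (n.factorial : ℝ) with hr
      have hr0 : 0 ≤ r := by positivity
      set e := Real.exp (2 * N * C * s)
      have h1 : ‖⁅evolve H s (H - H'), b⁆‖ ≤ ∑ Z ∈ Λ.powerset with ¬Disjoint Z X,
          2 * ‖Φ Z‖ * ‖b‖ * (K * e * ∑ z ∈ Z, ∑ y ∈ Y, F z y + M ^ n * r) := by
        rw [hsub, evolve_sum, Ring.lie_def, Finset.sum_mul, Finset.mul_sum,
          ← Finset.sum_sub_distrib]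
        exact (norm_sum_le _ _).trans (Finset.sum_le_sum fun Z _ => ih (hΦ.mem Z) hs)
      have h2 : ∀ D : Finset V → ℝ, ∑ Z ∈ Λ.powerset with ¬Disjoint Z X,
          2 * ‖Φ Z‖ * ‖b‖ * (K * e * D Z + M ^ n * r) =
          ‖b‖ * (2 * K * e * (∑ Z ∈ Λ.powerset with ¬Disjoint Z X, ‖Φ Z‖ * D Z) +
            M ^ n * r * (2 * ∑ Z ∈ Λ.powerset with ¬Disjoint Z X, ‖Φ Z‖)) := by
        intro D
        simp only [Finset.mul_sum, ← Finset.sum_add_distrib]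
        refine Finset.sum_congr rfl fun Z _ => ?_
        ring
      have h3 : ∑ Z ∈ Λ.powerset with ¬Disjoint Z X, ‖Φ Z‖ * ∑ z ∈ Z, ∑ y ∈ Y, F z y ≤
          N * C * ∑ x ∈ X, ∑ y ∈ Y, F x y := by
        refine (hΦ.sum_norm_mul_le Λ X
          fun z => Finset.sum_nonneg fun y _ => hΦ.kernel_nonneg z y).trans ?_
        rw [mul_assoc]
        refine mul_le_mul_of_nonneg_left ?_ hΦ.N_nonneg
        rw [Finset.mul_sum]
        refine Finset.sum_le_sum fun x _ => ?_
        simp only [Finset.mul_sum]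
        rw [Finset.sum_comm]
        exact Finset.sum_le_sum fun y _ => hΦ.convolution x y Λ
      have h4 : 2 * ∑ Z ∈ Λ.powerset with ¬Disjoint Z X, ‖Φ Z‖ ≤ M :=
        mul_le_mul_of_nonneg_left (Finset.sum_le_sum_of_subset_of_nonneg
          (Finset.filter_subset _ _) fun _ _ _ => norm_nonneg _) zero_le_two
      have he : 0 ≤ e := (Real.exp_pos _).le
      calc 2 * ‖a‖ * ‖⁅evolve H s (H - H'), b⁆‖
          ≤ 2 * ‖a‖ * (‖b‖ * (2 * K * e * (N * C * ∑ x ∈ X, ∑ y ∈ Y, F x y) +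
              M ^ n * r * M)) := by
            refine mul_le_mul_of_nonneg_left (h1.trans ((h2 _).trans_le ?_)) (by positivity)
            gcongr
        _ = 2 * ‖a‖ * ‖b‖ * (K * (e * (2 * N * C)) * ∑ x ∈ X, ∑ y ∈ Y, F x y +
              M ^ (n + 1) * r) := by ring

/-- The Lieb–Robinson bound. -/
theorem lieb_robinson (hΦ : IsDecayingInteraction S F K C N Φ) (Λ : Finset V)
    {X Y : Finset V} {a b : A} (ha : a ∈ S X) (hb : b ∈ S Y) {t : ℝ} (ht : 0 ≤ t) :
    ‖⁅evolve (∑ Z ∈ Λ.powerset, Φ Z) t a, b⁆‖ ≤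
      2 * ‖a‖ * ‖b‖ * (K * Real.exp (2 * N * C * t) * ∑ x ∈ X, ∑ y ∈ Y, F x y) := by
  have h := FloorSemiring.tendsto_pow_div_factorial_atTop ((2 * ∑ Z ∈ Λ.powerset, ‖Φ Z‖) * t)
  have h' := (h.const_add (K * Real.exp (2 * N * C * t) * ∑ x ∈ X, ∑ y ∈ Y, F x y)).const_mul
    (2 * ‖a‖ * ‖b‖)
  simp only [mul_pow, mul_div_assoc, add_zero] at h'
  refine ge_of_tendsto' h' fun n => ?_
  simpa only [mul_pow] using hΦ.lieb_robinson_iterate Λ hb n ha ht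

/-- The generators differ by the terms that meet `Λ' \ Λ`. The Lieb–Robinson bound applies to each,
and `sum_norm_mul_le` with the convolution property sums them up. -/
theorem norm_evolve_sub_le (hΦ : IsDecayingInteraction S F K C N Φ) {Λ Λ' : Finset V}
    (hΛ : Λ ⊆ Λ') {X : Finset V} {a : A} (ha : a ∈ S X) {t : ℝ} (ht : 0 ≤ t) :
    ‖evolve (∑ Z ∈ Λ'.powerset, Φ Z) t a - evolve (∑ Z ∈ Λ.powerset, Φ Z) t a‖ ≤
      2 * ‖a‖ * K * N * C * (∑ z ∈ Λ' \ Λ, ∑ x ∈ X, F x z) *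
        Real.exp ((2 * N * C + 1) * t) := by
  have hK := hΦ.K_nonneg
  have hN := hΦ.N_nonneg
  have hC := hΦ.C_nonneg
  set D := ∑ z ∈ Λ' \ Λ, ∑ x ∈ X, F x z with hD
  have hD0 : 0 ≤ D :=
    Finset.sum_nonneg fun z _ => Finset.sum_nonneg fun x _ => hΦ.kernel_nonneg x z
  have hsub : ∑ Z ∈ Λ'.powerset, Φ Z - ∑ Z ∈ Λ.powerset, Φ Z =
      ∑ Z ∈ Λ'.powerset with ¬Disjoint Z (Λ' \ Λ), Φ Z := by
    have : Λ.powerset = Λ'.powerset.filter (fun Z => Disjoint Z (Λ' \ Λ)) := by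
      ext Z
      simp only [Finset.mem_powerset, Finset.mem_filter]
      constructor
      · exact fun h => ⟨h.trans hΛ, Finset.disjoint_sdiff.mono_left h⟩
      · rintro ⟨h1, h2⟩ z hz
        by_contra hzΛ
        exact Finset.disjoint_left.1 h2 hz (Finset.mem_sdiff.2 ⟨h1 hz, hzΛ⟩)
    rw [this, ← Finset.sum_filter_add_sum_filter_not Λ'.powerset
      (fun Z => Disjoint Z (Λ' \ Λ)), add_sub_cancel_left]
  -- The rate `2 * N * C + 1` makes the derivative of the exponential dominate `exp (2 * N * C * s)`
  -- even when `N * C = 0`, without dividing by the rate.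
  refine norm_evolve_sub_evolve_le (hΦ.isSelfAdjoint_sum _) a
    (β := fun s => 2 * ‖a‖ * K * N * C * D * Real.exp ((2 * N * C + 1) * s))
    (β' := fun s => 2 * ‖a‖ * K * N * C * D *
      (Real.exp ((2 * N * C + 1) * s) * (2 * N * C + 1))) (by positivity) ?_ ht ?_
  · intro s
    have h1 : HasDerivAt (fun s => Real.exp ((2 * N * C + 1) * s))
        (Real.exp ((2 * N * C + 1) * s) * (2 * N * C + 1)) s := by
      simpa using ((hasDerivAt_id s).const_mul (2 * N * C + 1)).exp
    exact h1.const_mul _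
  · intro s hs
    have h1 : ‖⁅∑ Z ∈ Λ'.powerset, Φ Z - ∑ Z ∈ Λ.powerset, Φ Z,
        evolve (∑ Z ∈ Λ.powerset, Φ Z) s a⁆‖ ≤ ∑ Z ∈ Λ'.powerset with ¬Disjoint Z (Λ' \ Λ),
          2 * ‖a‖ * K * Real.exp (2 * N * C * s) * (‖Φ Z‖ * ∑ z ∈ Z, ∑ x ∈ X, F x z) := by
      rw [hsub, Ring.lie_def, Finset.sum_mul, Finset.mul_sum, ← Finset.sum_sub_distrib]
      refine (norm_sum_le _ _).trans (Finset.sum_le_sum fun Z _ => ?_)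
      rw [norm_sub_rev]
      refine (hΦ.lieb_robinson Λ ha (hΦ.mem Z) hs).trans_eq ?_
      rw [Finset.sum_comm]
      ring
    refine h1.trans ?_
    rw [← Finset.mul_sum]
    have h2 : ∑ Z ∈ Λ'.powerset with ¬Disjoint Z (Λ' \ Λ), ‖Φ Z‖ * ∑ z ∈ Z, ∑ x ∈ X, F x z ≤
        N * (C * D) := by
      refine (hΦ.sum_norm_mul_le Λ' _
        fun z => Finset.sum_nonneg fun x _ => hΦ.kernel_nonneg x z).trans ?_
      refine mul_le_mul_of_nonneg_left ?_ hN
      rw [hD, Finset.mul_sum]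
      refine Finset.sum_le_sum fun z _ => ?_
      simp only [Finset.mul_sum]
      rw [Finset.sum_comm]
      refine Finset.sum_le_sum fun x _ => ?_
      refine le_trans (le_of_eq ?_) (hΦ.convolution x z Λ')
      refine Finset.sum_congr rfl fun y _ => ?_
      rw [hΦ.kernel_symm z y, mul_comm]
    have h3 : Real.exp (2 * N * C * s) ≤
        Real.exp ((2 * N * C + 1) * s) * (2 * N * C + 1) := by
      refine le_trans (Real.exp_le_exp.2 ?_)
        (le_mul_of_one_le_right (Real.exp_pos _).le (by linarith [show 0 ≤ 2 * N * C by positivity]))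
      nlinarith
    calc _ ≤ 2 * ‖a‖ * K * Real.exp (2 * N * C * s) * (N * (C * D)) := by gcongr
      _ = 2 * ‖a‖ * K * N * C * D * Real.exp (2 * N * C * s) := by ring
      _ ≤ _ := by gcongr

/-- Existence of the thermodynamic limit of the dynamics, at nonnegative times. -/
theorem exists_tendsto_evolve_of_nonneg (hΦ : IsDecayingInteraction S F K C N Φ)
    (hF : ∀ x, Summable (F x)) {X : Finset V} {a : A} (ha : a ∈ S X) {t : ℝ} (ht : 0 ≤ t) :
    ∃ l, Tendsto (fun Λ : Finset V => evolve (∑ Z ∈ Λ.powerset, Φ Z) t a) atTop (𝓝 l) := by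
  refine cauchySeq_tendsto_of_complete (Metric.cauchySeq_iff'.2 fun ε hε => ?_)
  set κ := 2 * ‖a‖ * K * N * C * Real.exp ((2 * N * C + 1) * t) with hκ
  have hκ0 : 0 ≤ κ := by
    have hK := hΦ.K_nonneg
    have hN := hΦ.N_nonneg
    have hC := hΦ.C_nonneg
    positivity
  have hsum : Summable fun z => ∑ x ∈ X, F x z := summable_sum fun x _ => hF x
  obtain ⟨Λ, hΛ⟩ := summable_iff_vanishing_norm.1 hsum (ε / (κ + 1)) (by positivity)
  refine ⟨Λ, fun Λ' hΛ' => ?_⟩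
  rw [dist_eq_norm]
  have h1 := (le_abs_self _).trans_lt (hΛ (Λ' \ Λ) Finset.sdiff_disjoint)
  calc _ ≤ _ := hΦ.norm_evolve_sub_le hΛ' ha ht
    _ = κ * ∑ z ∈ Λ' \ Λ, ∑ x ∈ X, F x z := by rw [hκ]; ring
    _ ≤ κ * (ε / (κ + 1)) := by gcongr
    _ < ε := by
      rw [← mul_div_assoc, div_lt_iff₀ (by positivity)]
      nlinarith

/-- Changing the sign of the interaction reverses time, which reduces negative times to nonnegative
ones. -/
theorem neg (hΦ : IsDecayingInteraction S F K C N Φ) (hS : ∀ Z, ∀ a ∈ S Z, -a ∈ S Z) :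
    IsDecayingInteraction S F K C N (-Φ) :=
  { hΦ with
    selfAdjoint := fun Z => (hΦ.selfAdjoint Z).neg
    mem := fun Z => hS Z _ (hΦ.mem Z)
    decay := by simpa only [Pi.neg_apply, norm_neg] using hΦ.decay }

/-- Existence of the thermodynamic limit of the dynamics. -/
theorem exists_tendsto_evolve (hΦ : IsDecayingInteraction S F K C N Φ)
    (hS : ∀ Z, ∀ a ∈ S Z, -a ∈ S Z) (hF : ∀ x, Summable (F x)) {X : Finset V} {a : A}
    (ha : a ∈ S X) (t : ℝ) :
    ∃ l, Tendsto (fun Λ : Finset V => evolve (∑ Z ∈ Λ.powerset, Φ Z) t a) atTop (𝓝 l) := by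
  rcases le_total 0 t with ht | ht
  · exact hΦ.exists_tendsto_evolve_of_nonneg hF ha ht
  · simpa [evolve_neg_left] using
      (hΦ.neg hS).exists_tendsto_evolve_of_nonneg hF ha (neg_nonneg.2 ht)

end IsDecayingInteraction

end LiebRobinson

/-! ### Observables with disjoint supports commute -/

theorem embed_mul_embed_apply (ν k : ℕ) {X Y Λ : Volume ν} (hX : X ≤ Λ) (hY : Y ≤ Λ)
    (hXY : Disjoint X Y) (a : MatrixAlgebra ν k X) (b : MatrixAlgebra ν k Y)
    (σ τ : Config ν k Λ) :
    (embed ν k hX a * embed ν k hY b) σ τ =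
      a (fun x => σ ⟨x.1, hX x.2⟩) (fun x => τ ⟨x.1, hX x.2⟩) *
        b (fun x => σ ⟨x.1, hY x.2⟩) (fun x => τ ⟨x.1, hY x.2⟩) *
        if ∀ x : Λ, x.1 ∉ X → x.1 ∉ Y → σ x = τ x then 1 else 0 := by
  have hnX : ∀ x : Y, x.1 ∉ X := fun x hx => Finset.disjoint_left.1 hXY hx x.2
  have hnY : ∀ x : Λ, x.1 ∈ X → x.1 ∉ Y := fun x hx => Finset.disjoint_left.1 hXY hx
  -- The only intermediate configuration that contributes agrees with `τ` on `X` and with `σ` off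
  -- `X`.
  rw [Matrix.mul_apply, Finset.sum_eq_single (fun x => if x.1 ∈ X then τ x else σ x)]
  · rw [embed_apply, embed_apply]
    have h1 : ∀ x : Λ, x.1 ∉ X → σ x = if x.1 ∈ X then τ x else σ x := fun x hx => by
      rw [if_neg hx]
    have h2 : (∀ x : Λ, x.1 ∉ Y → (if x.1 ∈ X then τ x else σ x) = τ x) ↔
        ∀ x : Λ, x.1 ∉ X → x.1 ∉ Y → σ x = τ x := by
      refine forall_congr' fun x => ?_
      by_cases hx : x.1 ∈ X <;> simp [hx]
    rw [if_pos h1]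
    simp only [h2, hnX, if_false, Finset.coe_mem, if_true, mul_one]
    ring
  · intro ρ _ hρ
    rw [embed_apply, embed_apply]
    by_contra hne
    refine hρ (funext fun x => ?_)
    have h1 : ∀ x : Λ, x.1 ∉ X → σ x = ρ x := by
      by_contra h
      rw [if_neg h] at hne
      simp at hne
    have h2 : ∀ x : Λ, x.1 ∉ Y → ρ x = τ x := by
      by_contra h
      rw [if_neg h] at hne
      simp at hne
    split_ifs with hx
    · exact h2 x (hnY x hx)
    · exact (h1 x hx).symm
  · simp

theorem embed_commute (ν k : ℕ) {X Y Λ : Volume ν} (hX : X ≤ Λ) (hY : Y ≤ Λ)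
    (hXY : Disjoint X Y) (a : MatrixAlgebra ν k X) (b : MatrixAlgebra ν k Y) :
    Commute (embed ν k hX a) (embed ν k hY b) := by
  ext σ τ
  rw [embed_mul_embed_apply ν k hX hY hXY, embed_mul_embed_apply ν k hY hX hXY.symm,
    mul_comm (a _ _)]
  congr 2
  exact propext (forall_congr' fun x => ⟨fun h h1 h2 => h h2 h1, fun h h1 h2 => h h2 h1⟩)

section Quasilocal

variable {ν k : ℕ} [NeZero k]

theorem volumeAlgebra_commute {X Y : Volume ν} (hXY : Disjoint X Y) {a b : QuasilocalAlgebra ν k}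
    (ha : a ∈ volumeAlgebra ν k X) (hb : b ∈ volumeAlgebra ν k Y) : Commute a b := by
  obtain ⟨a, rfl⟩ := ha
  obtain ⟨b, rfl⟩ := hb
  have h := embed_commute ν k (Finset.subset_union_left (s₁ := X) (s₂ := Y))
    (Finset.subset_union_right (s₁ := X) (s₂ := Y)) hXY a b
  have := h.map ((ofLocal ν k).comp (toLocal ν k (X ∪ Y)))
  simpa [toLocal_embed] using this

/-! ### Separability and measurability -/

theorem isSeparable_volumeAlgebra (Λ : Volume ν) :
    TopologicalSpace.IsSeparable (volumeAlgebra ν k Λ : Set (QuasilocalAlgebra ν k)) := by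
  have hsep : TopologicalSpace.SeparableSpace (MatrixAlgebra ν k Λ) :=
    inferInstanceAs (TopologicalSpace.SeparableSpace (Config ν k Λ → Config ν k Λ → ℂ))
  have hc : Continuous ((ofLocal ν k).comp (toLocal ν k Λ)) :=
    LinearMap.continuous_of_finiteDimensional
      ((ofLocal ν k).comp (toLocal ν k Λ)).toAlgHom.toLinearMap
  exact TopologicalSpace.isSeparable_range hc

theorem isClosed_volumeAlgebra (Λ : Volume ν) :
    IsClosed (volumeAlgebra ν k Λ : Set (QuasilocalAlgebra ν k)) :=
  Submodule.closed_of_finiteDimensional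
    (LinearMap.range ((ofLocal ν k).comp (toLocal ν k Λ)).toAlgHom.toLinearMap)

/-- The local observables are dense and form a countable union of finite-dimensional spaces. -/
instance : SecondCountableTopology (QuasilocalAlgebra ν k) := by
  have h : TopologicalSpace.IsSeparable (Set.range (ofLocal ν k)) := by
    have : Set.range (ofLocal ν k) =
        ⋃ Λ : Volume ν, (volumeAlgebra ν k Λ : Set (QuasilocalAlgebra ν k)) := by
      ext a
      rw [Set.mem_iUnion]
      exact mem_localObservables ν k a
    rw [this]
    exact TopologicalSpace.IsSeparable.iUnion isSeparable_volumeAlgebra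
  have h' := h.closure
  rw [(denseRange_ofLocal ν k).closure_eq, TopologicalSpace.isSeparable_univ_iff] at h'
  exact UniformSpace.secondCountable_of_separable _

/-- Weakly measurable functions into a separable Banach space are measurable. -/
theorem measurable_of_forall_dual {Ω E : Type*} [MeasurableSpace Ω] [NormedAddCommGroup E]
    [NormedSpace ℂ E] [CompleteSpace E] [SecondCountableTopology E] [MeasurableSpace E]
    [BorelSpace E] {f : Ω → E} (hf : ∀ φ : StrongDual ℂ E, Measurable fun ω => φ (f ω)) :
    Measurable f := by
  -- Functionals norming a dense sequence separate points, so they map `E` continuously and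
  -- injectively into `ℂ^ℕ`.
  choose g hg1 hg2 using fun n => exists_dual_vector'' ℂ (TopologicalSpace.denseSeq E n)
  have hinj : Function.Injective fun x : E => fun n => g n x := by
    intro x y hxy
    rw [← sub_eq_zero, ← norm_le_zero_iff]
    refine le_of_forall_pos_le_add fun ε hε => ?_
    obtain ⟨n, hn⟩ := (TopologicalSpace.denseRange_denseSeq E).exists_dist_lt (x - y)
      (half_pos hε)
    set u := TopologicalSpace.denseSeq E n
    have h0 : g n (x - y) = 0 := by
      rw [map_sub, sub_eq_zero]
      exact congrFun hxy n
    rw [dist_eq_norm, norm_sub_rev] at hn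
    have h1 : ‖u‖ ≤ ‖u - (x - y)‖ := by
      have h2 : ‖g n (u - (x - y))‖ = ‖u‖ := by
        rw [map_sub, h0, sub_zero, hg2]
        simp [u]
      rw [← h2]
      exact (g n).le_of_opNorm_le (hg1 n) _ |>.trans_eq (one_mul _)
    have h3 : ‖x - y‖ ≤ ‖u‖ + ‖u - (x - y)‖ := by
      simpa using norm_sub_le u (u - (x - y))
    linarith
  have hcont : Continuous fun x : E => fun n => g n x :=
    continuous_pi fun n => (g n).continuous
  -- By the Lusin–Souslin theorem, a continuous injection of a Polish space is a measurable
  -- embedding.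
  rw [← (hcont.measurableEmbedding hinj).measurable_comp_iff]
  exact measurable_pi_lambda _ fun n => hf (g n)

/-! ### Disordered interactions: convergence and measurability of the dynamics -/

section Interaction

variable {Ω : Type*} {F : ℝ≥0 → ℝ≥0} {h : Ω → Volume ν → QuasilocalAlgebra ν k}

theorem localDynamics_eq_evolve (Λ : Volume ν) (t : ℝ) (ω : Ω) (a : QuasilocalAlgebra ν k) :
    localDynamics h Λ t ω a = evolve (∑ Z ∈ Λ.powerset, h ω Z) t a := by
  have key : ∀ s : ℝ, propagator h Λ ω s =
      NormedSpace.exp ((-s) • (Complex.I • ∑ Z ∈ Λ.powerset, h ω Z)) := by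
    intro s
    rw [propagator, hamiltonian, ← Complex.coe_smul, smul_smul]
    congr 2
    push_cast
    ring
  rw [localDynamics, key, key, evolve, neg_neg]

theorem isDecayingInteraction_of_mem_regularEvent (hF : IsFFunction ν F) {ω : Ω}
    (hω : ω ∈ regularEvent F h) :
    ∃ K C N : ℝ, IsDecayingInteraction
      (fun Z => (volumeAlgebra ν k Z : Set (QuasilocalAlgebra ν k)))
      (fun x y => (F (nndist x y) : ℝ)) K C N (h ω) := by
  obtain ⟨C, -, hC⟩ := hF.convolution
  obtain ⟨hfin, hloc⟩ := hω
  -- `K = 1 / F 0` normalizes the kernel on the diagonal.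
  refine ⟨(F 0 : ℝ)⁻¹, C, (fNorm F h ω).toReal, ?_⟩
  have hdecay : ∀ (x y : Site ν) (Λ : Volume ν),
      ∑ Z ∈ Λ.powerset with x ∈ Z ∧ y ∈ Z, ‖h ω Z‖ₑ ≤ fNorm F h ω * F (nndist x y) := by
    intro x y Λ
    have hpos : (F (nndist x y) : ℝ≥0∞) ≠ 0 := by simpa using (hF.pos _).ne'
    have h1 : ∑' Z : {Z : Volume ν // x ∈ Z ∧ y ∈ Z}, ‖h ω Z‖ₑ * (F (nndist x y) : ℝ≥0∞)⁻¹ ≤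
        fNorm F h ω :=
      le_iSup₂ (f := fun x y : Site ν => ∑' Z : {Z : Volume ν // x ∈ Z ∧ y ∈ Z},
        ‖h ω Z‖ₑ * (F (nndist x y) : ℝ≥0∞)⁻¹) x y
    rw [ENNReal.tsum_mul_right, ← div_eq_mul_inv, ENNReal.div_le_iff hpos ENNReal.coe_ne_top] at h1
    refine le_trans ?_ h1
    rw [← Finset.sum_subtype_eq_sum_filter]
    exact ENNReal.sum_le_tsum _
  constructor
  · exact fun hXY _ _ ha hb => volumeAlgebra_commute hXY ha hb
  · exact fun Z => (hloc Z).1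
  · exact fun Z => (hloc Z).2
  · exact fun x y => NNReal.coe_nonneg _
  · exact fun x y => by rw [nndist_comm]
  · positivity
  · positivity
  · exact ENNReal.toReal_nonneg
  · intro x
    rw [nndist_self, inv_mul_cancel₀]
    exact_mod_cast (hF.pos 0).ne'
  · intro x y Λ
    have h1 := (ENNReal.sum_le_tsum Λ).trans (hC x y)
    exact_mod_cast h1
  · intro x y Λ
    have h1 := ENNReal.toReal_mono (ENNReal.mul_ne_top hfin.ne ENNReal.coe_ne_top) (hdecay x y Λ)
    rw [ENNReal.toReal_sum fun Z _ => enorm_ne_top, ENNReal.toReal_mul] at h1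
    simpa using h1

theorem IsFFunction.summable_kernel (hF : IsFFunction ν F) (x : Site ν) :
    Summable fun y => (F (nndist x y) : ℝ) := by
  have h1 := (le_iSup (fun x : Site ν => ∑' y : Site ν, (F (nndist x y) : ℝ≥0∞)) x).trans_lt
    hF.summable
  exact NNReal.summable_coe.2 (ENNReal.tsum_coe_ne_top_iff_summable.1 h1.ne)

/-- The limit is taken along the net of all finite volumes, so that it cannot depend on a sequence.
-/
theorem exists_tendsto_localDynamics (hF : IsFFunction ν F) {ω : Ω} (hω : ω ∈ regularEvent F h)
    (t : ℝ) (a : localObservables ν k) :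
    ∃ l, Tendsto (fun Λ : Volume ν => localDynamics h Λ t ω a) atTop (𝓝 l) := by
  obtain ⟨X, hX⟩ := (mem_localObservables ν k a).1 a.2
  obtain ⟨K, C, N, hΦ⟩ := isDecayingInteraction_of_mem_regularEvent hF hω
  simp only [localDynamics_eq_evolve]
  exact hΦ.exists_tendsto_evolve (fun Z a ha => neg_mem ha) hF.summable_kernel hX t

theorem IsIAS.tendsto_atTop {Λ : ℕ → Volume ν} (hΛ : IsIAS Λ) : Tendsto Λ atTop atTop :=
  tendsto_atTop_finset_of_monotone (monotone_nat_of_le_succ hΛ.subset_succ) hΛ.absorbing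

variable [MeasurableSpace Ω] [MeasurableSpace (QuasilocalAlgebra ν k)]
  [BorelSpace (QuasilocalAlgebra ν k)]

theorem measurable_localDynamics (hm : ∀ Z, Measurable fun ω => h ω Z) (Λ : Volume ν) (t : ℝ)
    (a : QuasilocalAlgebra ν k) : Measurable fun ω => localDynamics h Λ t ω a := by
  have hH : Measurable (hamiltonian h Λ) := Finset.measurable_fun_sum _ fun Z _ => hm Z
  have hU : ∀ s : ℝ, Measurable fun ω => propagator h Λ ω s := by
    intro s
    let +nondep : NormedAlgebra ℚ (QuasilocalAlgebra ν k) := .restrictScalars ℚ ℂ _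
    exact NormedSpace.exp_continuous.measurable.comp (hH.fun_const_smul _)
  exact ((hU (-t)).mul_const a).mul (hU t)

/-- Sites and volumes are countable, and each `A_Z` is closed because it is finite-dimensional. -/
theorem measurableSet_regularEvent (hm : ∀ Z, Measurable fun ω => h ω Z) :
    MeasurableSet (regularEvent F h) := by
  have hN : Measurable (fNorm F h) :=
    Measurable.iSup fun x => Measurable.iSup fun y => Measurable.tsum fun Z =>
      (hm Z).enorm.mul_const _
  refine (measurableSet_lt hN measurable_const).inter ?_
  change MeasurableSet {ω | ∀ Z, IsSelfAdjoint (h ω Z) ∧ h ω Z ∈ volumeAlgebra ν k Z}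
  rw [Set.ofPred_forall]
  refine MeasurableSet.iInter fun Z => MeasurableSet.inter ?_ ?_
  · exact measurableSet_eq_fun ((continuous_star_quasilocal ν k).measurable.comp (hm Z)) (hm Z)
  · exact hm Z (isClosed_volumeAlgebra Z).measurableSet

end Interaction

end Quasilocal

end SpinSystem

/-! ### The main theorem -/

open SpinSystem in
theorem mainTheorem7 {ν k : ℕ} [NeZero k] {Ω : Type*} [MeasurableSpace Ω]
    (P : Measure Ω) [IsProbabilityMeasure P] (F : ℝ≥0 → ℝ≥0) (hF : IsFFunction ν F)
    (h : Ω → Volume ν → QuasilocalAlgebra ν k) (hh : IsDisorderedInteraction P h)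
    (hfin : ∀ᵐ ω ∂P, fNorm F h ω < ∞) :
    MeasurableSet (regularEvent F h) ∧ P (regularEvent F h) = 1 ∧
    ∃ α : ℝ → Ω → localObservables ν k → QuasilocalAlgebra ν k,
      (∀ Λ : ℕ → Volume ν, IsIAS Λ → ∀ ω ∈ regularEvent F h, ∀ t : ℝ,
        ∀ a : localObservables ν k,
          Tendsto (fun n => localDynamics h (Λ n) t ω a) atTop (𝓝 (α t ω a))) ∧
      (∀ ω ∉ regularEvent F h, ∀ t a, α t ω a = 0) ∧
      (∀ t a, ∀ φ : StrongDual ℂ (QuasilocalAlgebra ν k), Measurable fun ω => φ (α t ω a)) := by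
  classical
  borelize (QuasilocalAlgebra ν k)
  have hm : ∀ Z, Measurable fun ω => h ω Z := fun Z =>
    measurable_of_forall_dual (hh.measurable Z)
  have hG := measurableSet_regularEvent (F := F) hm
  refine ⟨hG, ?_, ?_⟩
  · rw [prob_compl_eq_zero_iff hG |>.symm]
    exact mem_ae_iff.1 (hfin.and (ae_all_iff.2 hh.selfAdjoint))
  · choose! l hl using fun (ω : Ω) (hω : ω ∈ regularEvent F h) =>
      fun (t : ℝ) (a : localObservables ν k) => exists_tendsto_localDynamics hF hω t a
    refine ⟨fun t ω a => if ω ∈ regularEvent F h then l ω t a else 0, ?_, ?_, ?_⟩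
    · intro Λ hΛ ω hω t a
      simp only [if_pos hω]
      exact (hl ω hω t a).comp hΛ.tendsto_atTop
    · intro ω hω t a
      exact if_neg hω
    · intro t a φ
      refine φ.continuous.measurable.comp ?_
      -- There are countably many volumes, so `atTop` is countably generated. Cutting off outside
      -- the regular event makes the net converge for every `ω`.
      refine measurable_of_tendsto_metrizable' (atTop : Filter (Volume ν))
        (f := fun Λ ω => if ω ∈ regularEvent F h then localDynamics h Λ t ω a else 0)
        (fun Λ => Measurable.ite hG (measurable_localDynamics hm Λ t a) measurable_const) ?_
      refine tendsto_pi_nhds.2 fun ω => ?_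
      by_cases hω : ω ∈ regularEvent F h
      · simpa only [if_pos hω] using hl ω hω t a
      · simpa only [if_neg hω] using tendsto_const_nhds
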